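/- Fix a continuous activation function $\sigma:\mathbb R\to\mathbb R$ that is not a polynomial, and let $V=L^2(\mathbb R^\nu,\mathbb R^{d_V})$ with its norm topology. For an integer $L\ge 0$ let $Z_L=\{\mathbf k\in\mathbb Z^\nu:\|\mathbf k\|_\infty\le L\}$. For $\lambda>0$ let $P_{\lambda,\lambda L}$ be the orthogonal projector of $V$ onto the signals that are constant on each cube $Q_{\mathbf k}=\prod_{i=1}^\nu[(k_i-\frac12)\lambda,(k_i+\frac12)\lambda]$ and vanish on the cubes with $\mathbf k\notin Z_L$. Thus $P_{\lambda,\lambda L}\mathbf\Phi$ is given by the values $\lambda^{-\nu}\int_{Q_{\mathbf k}}\mathbf\Phi(\theta)\,d\theta$, $\mathbf k\in Z_L$, and is regarded as a function $Z_L\to\mathbb R^{d_V}$. Let $s\ge1$ (the stride), $L_{\mathrm{rf}}\ge1$ (the receptive field parameter) and $T\ge1$ (the depth) be integers. Put $L_{t,T}=L_{\mathrm{rf}}(1+s+\dots+s^{T-t-1})$ for $1\le t<T$ and $L_{T,T}=0$, so that $L_{t,T}=sL_{t+1,T}+L_{\mathrm{rf}}$. A convnet with downsampling with stride $s$, receptive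 field parameter $L_{\mathrm{rf}}$, depth $T$ and spacing $\lambda>0$ is a map $$\widehat f=\widehat f_T\circ\dots\circ\widehat f_1\circ P_{\lambda,\lambda L_{1,T}}:V\to\mathbb R,$$ where, for some feature dimensions $d_1=d_V,d_2,\dots,d_T$ and real coefficients $w^{(t)}_{n\theta k},h^{(t)}_n$ ($t<T$) and $w^{(T)}_k,h^{(T)}$, the layer $\widehat f_t$ with $t<T$ maps functions $Z_{L_{t,T}}\to\mathbb R^{d_t}$ to functions $Z_{L_{t+1,T}}\to\mathbb R^{d_{t+1}}$ by $$\widehat f_t(\mathbf\Phi)_{\gamma n}=\sigma\Big(\sum_{\theta\in Z_{L_{\mathrm{rf}}}}\sum_{k=1}^{d_t}w^{(t)}_{n\theta k}\Phi_{s\gamma+\theta,k}+h^{(t)}_n\Big),\qquad \gamma\in Z_{L_{t+1,T}},\ n=1,\dots,d_{t+1},$$ and $\widehat f_T(\mathbf\Phi)=\sum_{k=1}^{d_T}w^{(T)}_k\Phi_k+h^{(T)}$ for $\mathbf\Phi\in\mathbb R^{d_T}$ (a function on the single node of $Z_0$). A map $f:V\to\mathbb R$ is called a limit point of convnets with downsampling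 if for all integers $s\ge1$, $L_{\mathrm{rf}}\ge1$ with $s\le 2L_{\mathrm{rf}}+1$, every compact set $K\subset V$ and all $\epsilon>0$, $\lambda_0>0$, $\Lambda_0>0$ there is a convnet with downsampling $\widehat f$ with stride $s$, receptive field parameter $L_{\mathrm{rf}}$, some depth $T$ and some spacing $\lambda\le\lambda_0$ such that $\lambda L_{1,T}\ge\Lambda_0$ and $\sup_{\mathbf\Phi\in K}|\widehat f(\mathbf\Phi)-f(\mathbf\Phi)|<\epsilon$. Theorem. A map $f:V\to\mathbb R$ is a limit point of convnets with downsampling if and only if $f$ is continuous in the norm topology. -/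

import Mathlib

open MeasureTheory

noncomputable section

/-- The space `V = L²(ℝ^ν, ℝ^{d_V})` of square-integrable `d_V`-component signals on `ℝ^ν`. -/
abbrev Signal (ν dV : ℕ) : Type :=
  Lp (EuclideanSpace ℝ (Fin dV)) 2 (volume : Measure (EuclideanSpace ℝ (Fin ν)))

/-- The cubic grid `Z_L = {k ∈ ℤ^ν : ‖k‖_∞ ≤ L}`, i.e. all coordinates lie in `[-L, L]`. -/
def cubicGrid (ν L : ℕ) : Finset (Fin ν → ℤ) :=
  Finset.Icc (fun _ => -(L : ℤ)) (fun _ => (L : ℤ))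

/-- The cube `Q_k = ∏ᵢ [(kᵢ - 1/2) spacing, (kᵢ + 1/2) spacing]` in `ℝ^ν`. -/
def gridCube {ν : ℕ} (spacing : ℝ) (k : Fin ν → ℤ) : Set (EuclideanSpace ℝ (Fin ν)) :=
  {x | ∀ i, ((k i : ℝ) - 1 / 2) * spacing ≤ x i ∧ x i ≤ ((k i : ℝ) + 1 / 2) * spacing}

/-- The discretized and cut-off signal. The orthogonal projector of `L²(ℝ^ν, ℝ^{d_V})` onto the
signals that are constant on every cube `Q_k` and vanish on the cubes with `k ∉ Z_L` replaces a
signal by its mean value on each cube `Q_k`, `k ∈ Z_L`. The projected signal is recorded by its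
values at the nodes of the grid. -/
def discretize {ν dV : ℕ} (spacing : ℝ) (L : ℕ) (Φ : Signal ν dV) :
    cubicGrid ν L → Fin dV → ℝ :=
  fun k n => ((spacing ^ ν)⁻¹ • ∫ x in gridCube spacing k.1, Φ x) n

/-- The range of the grid on which the signal lives when `r` convolutional layers remain to be
applied: `L_rf (1 + s + ⋯ + s^{r-1})`. With depth `T` this is `L_{t,T}` for `r = T - t`. -/
def gridRange (s Lrf r : ℕ) : ℕ := Lrf * ∑ j ∈ Finset.range r, s ^ j

theorem gridRange_succ (s Lrf r : ℕ) :
    gridRange s Lrf (r + 1) = s * gridRange s Lrf r + Lrf := by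
  unfold gridRange
  rw [Finset.sum_range_succ', mul_add, pow_zero, mul_one, Finset.mul_sum, Finset.mul_sum,
    Finset.mul_sum]
  congr 1
  refine Finset.sum_congr rfl fun j _ => ?_
  ring

theorem zero_mem_cubicGrid (ν L : ℕ) : (0 : Fin ν → ℤ) ∈ cubicGrid ν L := by
  simp [cubicGrid, Finset.mem_Icc, Pi.le_def]

/-- The node `s γ + θ` of the finer grid, which the node `γ` of the next (downsampled) grid reads
at the position `θ` of its receptive field. -/
def readNode {ν s Lrf r : ℕ} (γ : cubicGrid ν (gridRange s Lrf r)) (θ : cubicGrid ν Lrf) :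
    cubicGrid ν (gridRange s Lrf (r + 1)) :=
  ⟨fun i => (s : ℤ) * γ.1 i + θ.1 i, by
    have hγ := γ.2
    have hθ := θ.2
    simp only [cubicGrid, Finset.mem_Icc, Pi.le_def] at hγ hθ ⊢
    have hs : (0 : ℤ) ≤ (s : ℤ) := Int.natCast_nonneg s
    rw [gridRange_succ]
    push_cast
    refine ⟨fun i => ?_, fun i => ?_⟩
    · have h1 := mul_le_mul_of_nonneg_left (hγ.1 i) hs
      have h2 := hθ.1 i
      linarith
    · have h1 := mul_le_mul_of_nonneg_left (hγ.2 i) hs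
      have h2 := hθ.2 i
      linarith⟩

/-- The coefficients of a chain of `r` convolutional layers with receptive field `Z_{L_rf}`,
starting from feature dimension `d`, followed by a final linear layer with a scalar output.
The weights `w n θ k` and the biases `h n` of a layer do not depend on the node of the grid, and
the feature dimensions `d'` between the layers are arbitrary. -/
inductive ConvLayers (ν Lrf : ℕ) : ℕ → ℕ → Type
  | readout {d : ℕ} (w : Fin d → ℝ) (h : ℝ) : ConvLayers ν Lrf 0 d
  | conv {r d d' : ℕ} (w : Fin d' → cubicGrid ν Lrf → Fin d → ℝ) (h : Fin d' → ℝ)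
      (rest : ConvLayers ν Lrf r d') : ConvLayers ν Lrf (r + 1) d

/-- The action of the layers with activation function `σ` and stride `s`. A convolutional layer
maps `Φ` to `(γ, n) ↦ σ (∑ θ ∈ Z_{L_rf}, ∑ k, w n θ k * Φ (s γ + θ, k) + h n)`; the final layer
maps `Φ`, which lives on the one-node grid `Z_0`, to `∑ k, w k * Φ (0, k) + h`. -/
def ConvLayers.eval (σ : ℝ → ℝ) {ν Lrf : ℕ} (s : ℕ) :
    {r d : ℕ} → ConvLayers ν Lrf r d → (cubicGrid ν (gridRange s Lrf r) → Fin d → ℝ) → ℝ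
  | _, _, .readout w h, Φ => (∑ k, w k * Φ ⟨0, zero_mem_cubicGrid ν _⟩ k) + h
  | _, _, .conv w h rest, Φ =>
      rest.eval σ s fun γ n => σ ((∑ θ, ∑ k, w n θ k * Φ (readNode γ θ) k) + h n)

/-- A convnet with downsampling on `L²(ℝ^ν, ℝ^{d_V})` with receptive field parameter `L_rf`:
a grid spacing, the number `T - 1` of convolutional layers (where `T ≥ 1` is the depth), and the
coefficients of all layers. -/
structure DownsamplingConvnet (ν dV Lrf : ℕ) where
  spacing : ℝ
  spacing_pos : 0 < spacing
  numConv : ℕ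
  layers : ConvLayers ν Lrf numConv dV

/-- The range `L_{1,T}` of the input grid of the convnet with stride `s`. -/
def DownsamplingConvnet.inputRange {ν dV Lrf : ℕ} (N : DownsamplingConvnet ν dV Lrf) (s : ℕ) : ℕ :=
  gridRange s Lrf N.numConv

/-- The map `V → ℝ` computed by a convnet with downsampling with stride `s` and activation
function `σ`: discretization and cutoff of the signal, then the layers one after another. -/
def DownsamplingConvnet.toFun (σ : ℝ → ℝ) {ν dV Lrf : ℕ} (s : ℕ)
    (N : DownsamplingConvnet ν dV Lrf) (Φ : Signal ν dV) : ℝ :=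
  N.layers.eval σ s (discretize N.spacing (N.inputRange s) Φ)

/-- `f : V → ℝ` is a limit point of convnets with downsampling (with activation function `σ`): for
every stride `s ≥ 1` and every receptive field parameter `L_rf ≥ 1` with `s ≤ 2 L_rf + 1`, it can
be uniformly approximated on every compact set by such convnets of arbitrarily small spacing and
arbitrarily large spatial range. The supremum of the error is taken in `[0, ∞]`. -/
def IsLimitPointOfDownsamplingConvnets (σ : ℝ → ℝ) {ν dV : ℕ} (f : Signal ν dV → ℝ) : Prop :=
  ∀ s Lrf : ℕ, 1 ≤ s → 1 ≤ Lrf → s ≤ 2 * Lrf + 1 →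
    ∀ K : Set (Signal ν dV), IsCompact K →
      ∀ ε > (0 : ℝ), ∀ spacing₀ > (0 : ℝ), ∀ range₀ > (0 : ℝ),
        ∃ N : DownsamplingConvnet ν dV Lrf,
          N.spacing ≤ spacing₀ ∧
          range₀ ≤ N.spacing * (N.inputRange s : ℝ) ∧
          (⨆ Φ ∈ K, edist (N.toFun σ s Φ) (f Φ)) < ENNReal.ofReal ε

end

/-!
Limit points are continuous because every convnet is continuous: a map that is uniformly
approximated by continuous maps on each set `{Φ} ∪ {Φₙ}`, with `Φₙ → Φ`, is sequentially continuous
(`IsLimitPointOfDownsamplingConvnets.continuous`).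

The converse reduces a continuous `f` to a function of finitely many variables. Let `stepSignal`
turn the node values recorded by `discretize` back into a signal. The composition of the two is the
orthogonal projector onto step functions, so it is at least as close to the identity as any
explicit approximation by step functions, and approximating finitely many compactly supported
continuous signals makes it uniformly close to the identity on a compact set
(`exists_forall_mem_norm_sub_stepSignal_discretize_le`). It then remains to approximate the
continuous function `f ∘ stepSignal` on the compact image of `discretize`.

This is done by induction on the number of convolutional layers (`ConvLayers.exists_eval_approx`).
As `s ≤ 2 L_rf + 1`, the receptive fields cover the grid, so copying each receptive field into the
features of a node of the next grid loses no information. A convolutional layer realizes this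
copying approximately, once the identity of `ℝ` is written approximately as a combination of
functions `σ (w x + b)`; the outer coefficients of the combination are absorbed into the weights of
the following layer (`ConvLayers.exists_eval_eq_eval_mix`). The last convolutional layer together
with the readout is a one-hidden-layer network in all the remaining variables.

Both uses of `σ` rest on the density theorem for one-hidden-layer networks (`eq_top_of_ridge_mem`).
Let `S` be a closed subspace of `C(X, ℝ)`, with `X` compact, that contains all `σ ∘ (u + b)` with
`u` in a point-separating subspace `U`. Mollification `g = φ ⋆ σ` keeps `g ∘ (a u + b)` in `S`, and
differentiating `n` times in `a` at `a = 0` gives `u ^ n * g⁽ⁿ⁾(b) ∈ S`. For each `n` some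
mollification has a nonzero `n`-th derivative somewhere: otherwise all of them are polynomials of
degree at most `n`, and so is their limit `σ`. Hence `S` contains all powers `u ^ n`, then all
`exp u`, and the span of the latter is a subalgebra that separates points.
-/

/-! ### Mollifications of a non-polynomial function -/

theorem exists_polynomial_of_iteratedDeriv_eq_zero {f : ℝ → ℝ} {n : ℕ}
    (hf : ContDiff ℝ (n + 1) f) (h : ∀ x, iteratedDeriv (n + 1) f x = 0) :
    ∃ p : Polynomial ℝ, p.degree < (n + 1 : ℕ) ∧ ∀ x, f x = p.eval x := by
  refine ⟨∑ k ∈ Finset.range (n + 1),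
    Polynomial.monomial k (((k.factorial : ℝ))⁻¹ * iteratedDeriv k f 0), ?_, fun x => ?_⟩
  · refine lt_of_le_of_lt (Polynomial.degree_sum_le _ _) ?_
    rw [Finset.sup_lt_iff (WithBot.bot_lt_coe _)]
    intro k hk
    exact lt_of_le_of_lt (Polynomial.degree_monomial_le _ _)
      (by exact_mod_cast Finset.mem_range.1 hk)
  · rw [Polynomial.eval_finsetSum]
    rcases eq_or_ne 0 x with rfl | hx
    · rw [Finset.sum_eq_single 0]
      · simp
      · intro k _ hk
        simp [hk]
      · simp
    · obtain ⟨y, -, hy⟩ := taylor_mean_remainder_lagrange_iteratedDeriv (n := n) hx hf.contDiffOn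
      rw [h y, zero_mul, zero_div, sub_eq_zero, taylor_within_apply] at hy
      rw [hy]
      refine Finset.sum_congr rfl fun k hk => ?_
      rw [iteratedDerivWithin_eq_iteratedDeriv (uniqueDiffOn_uIcc hx) _ Set.left_mem_uIcc]
      · simp only [sub_zero, smul_eq_mul, Polynomial.eval_monomial]
        ring
      · refine (hf.of_le ?_).contDiffAt
        exact_mod_cast (Finset.mem_range.1 hk).le

open Filter Topology in
/-- A pointwise limit of polynomials of degree less than `n` is a polynomial: Lagrange interpolation
at `n` fixed nodes expresses such polynomials linearly through their values there. -/
theorem exists_polynomial_of_tendsto {ι : Type*} {l : Filter ι} [l.NeBot] {F : ι → ℝ → ℝ}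
    {f : ℝ → ℝ} {n : ℕ}
    (hF : ∀ i, ∃ p : Polynomial ℝ, p.degree < n ∧ ∀ x, F i x = p.eval x)
    (h : ∀ x, Tendsto (fun i => F i x) l (𝓝 (f x))) :
    ∃ p : Polynomial ℝ, ∀ x, f x = p.eval x := by
  have hv : Set.InjOn (fun k : ℕ => (k : ℝ)) (Finset.range n) := Nat.cast_injective.injOn
  have key : ∀ (r : ℕ → ℝ) (x : ℝ),
      (Lagrange.interpolate (Finset.range n) (fun k : ℕ => (k : ℝ)) r).eval x =
        ∑ k ∈ Finset.range n,
          r k * (Lagrange.basis (Finset.range n) (fun k : ℕ => (k : ℝ)) k).eval x := by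
    intro r x
    simp [Lagrange.interpolate_apply, Polynomial.eval_finsetSum]
  refine ⟨Lagrange.interpolate (Finset.range n) (fun k : ℕ => (k : ℝ)) (fun k => f k),
    fun x => tendsto_nhds_unique (h x) ?_⟩
  have : ∀ i, F i x = ∑ k ∈ Finset.range n,
      F i k * (Lagrange.basis (Finset.range n) (fun k : ℕ => (k : ℝ)) k).eval x := by
    intro i
    obtain ⟨p, hp, hpF⟩ := hF i
    rw [← key (fun k => F i k), hpF x]
    congr 1
    refine Lagrange.eq_interpolate_of_eval_eq _ hv (by simpa using hp) fun k _ => (hpF k).symm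
  simp_rw [this, key]
  exact tendsto_finsetSum _ fun k _ => (h k).mul_const _

open Filter Topology Convolution ContinuousLinearMap in
/-- A continuous `σ` that is not a polynomial has, for each `n`, a mollification whose `n`-th
derivative does not vanish identically. The mollifier may depend on `n`, so no uniform bound on
degrees is needed. -/
theorem exists_iteratedDeriv_convolution_ne_zero {σ : ℝ → ℝ} (hσ : Continuous σ)
    (hσ' : ¬ ∃ p : Polynomial ℝ, ∀ x : ℝ, σ x = p.eval x) (n : ℕ) :
    ∃ (φ : ContDiffBump (0 : ℝ)) (b : ℝ),
      iteratedDeriv n (φ.normed volume ⋆[lsmul ℝ ℝ, volume] σ) b ≠ 0 := by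
  by_contra! H
  refine hσ' ?_
  let φ : ℕ → ContDiffBump (0 : ℝ) := fun i =>
    ⟨1 / (i + 1 : ℝ) / 2, 1 / (i + 1 : ℝ), by positivity, half_lt_self (by positivity)⟩
  refine exists_polynomial_of_tendsto (l := atTop) (n := n + 1)
    (F := fun i => (φ i).normed volume ⋆[lsmul ℝ ℝ, volume] σ) (fun i => ?_) fun x => ?_
  · refine exists_polynomial_of_iteratedDeriv_eq_zero ?_ fun x => ?_
    · exact_mod_cast (φ i).hasCompactSupport_normed.contDiff_convolution_left
        (n := ((n + 1 : ℕ) : ℕ∞)) _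
        ((φ i).contDiff_normed (n := n + 1)) hσ.locallyIntegrable
    · rw [iteratedDeriv_succ, funext (H (φ i))]
      simp
  · refine ContDiffBump.convolution_tendsto_right_of_continuous ?_ hσ x
    exact tendsto_one_div_add_atTop_nhds_zero_nat

/-! ### Density of ridge functions -/

theorem Submodule.integral_mem_of_isClosed {α E : Type*} [MeasurableSpace α] {μ : Measure α}
    [NormedAddCommGroup E] [NormedSpace ℝ E] [CompleteSpace E] {S : Submodule ℝ E}
    (hS : IsClosed (S : Set E)) {F : α → E} (hF : Integrable F μ) (h : ∀ t, F t ∈ S) :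
    ∫ t, F t ∂μ ∈ S := by
  have hq := S.mkQL.integral_comp_comm hF
  -- The quotient by the closed subspace `S` is a normed space, in which the integral vanishes.
  have h0 : ∀ t, S.mkQL (F t) = 0 := fun t => (Submodule.Quotient.mk_eq_zero S).2 (h t)
  simp only [h0, integral_zero] at hq
  exact (Submodule.Quotient.mk_eq_zero S).1 hq.symm

theorem Submodule.deriv_mem_of_isClosed {E : Type*} [NormedAddCommGroup E] [NormedSpace ℝ E]
    {S : Submodule ℝ E} (hS : IsClosed (S : Set E)) {F : ℝ → E} {F' : E} {a : ℝ}
    (hF : HasDerivAt F F' a) (h : ∀ t, F t ∈ S) : F' ∈ S := by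
  refine hS.mem_of_tendsto (hasDerivAt_iff_tendsto_slope.1 hF)
    (Filter.Eventually.of_forall fun t => ?_)
  rw [slope_def_module]
  exact S.smul_mem _ (S.sub_mem (h t) (h a))

section Ridge

variable {X : Type*} [TopologicalSpace X] [CompactSpace X]

/-- A curve in `C(X, ℝ)` is differentiable in the sup norm if it is differentiable pointwise and the
pointwise derivatives form a continuous curve: it is then the Bochner integral of its derivative. -/
theorem ContinuousMap.hasDerivAt_of_forall_hasDerivAt {F F' : ℝ → C(X, ℝ)} (hF' : Continuous F')
    (h : ∀ t x, HasDerivAt (fun t => F t x) (F' t x) t) (a : ℝ) : HasDerivAt F (F' a) a := by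
  have hF : F = fun t => F 0 + ∫ s in (0 : ℝ)..t, F' s := by
    funext t
    ext x
    have h1 := (ContinuousMap.evalCLM ℝ x).intervalIntegral_comp_comm
      (hF'.intervalIntegrable (μ := volume) 0 t)
    have h2 := intervalIntegral.integral_eq_sub_of_hasDerivAt (fun s _ => h s x)
      (((ContinuousMap.evalCLM ℝ x).continuous.comp hF').intervalIntegrable (μ := volume) 0 t)
    simp only [ContinuousMap.evalCLM_apply] at h1 h2
    rw [ContinuousMap.add_apply, ← h1, h2]
    ring
  rw [hF]
  exact ((hF'.integral_hasStrictDerivAt 0 a).hasDerivAt).const_add _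

theorem ContinuousMap.continuous_mul_comp {X : Type*} [TopologicalSpace X]
    (g : C(ℝ, ℝ)) (v u : C(X, ℝ)) (b : ℝ) :
    Continuous fun a : ℝ => v * g.comp (a • u + ContinuousMap.const X b) := by
  let G : C(ℝ × X, ℝ) := ⟨fun p => v p.2 * g (p.1 * u p.2 + b), by fun_prop⟩
  exact G.curry.continuous

/-- The derivative of `u ^ n * g⁽ⁿ⁾ (a u + b)` in the dilation parameter `a` is
`u ^ (n + 1) * g⁽ⁿ⁺¹⁾ (a u + b)`, so a closed subspace that contains the dilates `g (a u + b)`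
contains all of these functions. -/
theorem ridge_pow_mul_iteratedDeriv_mem {S : Submodule ℝ C(X, ℝ)}
    (hS : IsClosed (S : Set C(X, ℝ))) {u : C(X, ℝ)} {b : ℝ} {g : C(ℝ, ℝ)}
    (hg : ContDiff ℝ (⊤ : ℕ∞) g) (h : ∀ a : ℝ, g.comp (a • u + ContinuousMap.const X b) ∈ S)
    (n : ℕ) (a : ℝ) :
    u ^ n * (⟨iteratedDeriv n g, hg.continuous_iteratedDeriv n (mod_cast le_top)⟩ : C(ℝ, ℝ)).comp
      (a • u + ContinuousMap.const X b) ∈ S := by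
  induction n generalizing a with
  | zero =>
    convert h a using 1
    ext x
    simp
  | succ n ih =>
    refine Submodule.deriv_mem_of_isClosed hS (a := a) ?_ ih
    refine ContinuousMap.hasDerivAt_of_forall_hasDerivAt (F' := fun a => u ^ (n + 1) *
      (⟨iteratedDeriv (n + 1) g, hg.continuous_iteratedDeriv (n + 1) (mod_cast le_top)⟩ :
        C(ℝ, ℝ)).comp (a • u + ContinuousMap.const X b)) ?_ (fun t x => ?_) a
    · exact ContinuousMap.continuous_mul_comp _ _ _ _
    · have h1 : HasDerivAt (iteratedDeriv n g) (iteratedDeriv (n + 1) g (t * u x + b))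
          (t * u x + b) := by
        rw [iteratedDeriv_succ]
        exact ((hg.differentiable_iteratedDeriv n (mod_cast WithTop.coe_lt_top _)) _).hasDerivAt
      have h2 : HasDerivAt (fun t : ℝ => t * u x + b) (u x) t := by
        simpa using ((hasDerivAt_id t).mul_const (u x)).add_const b
      have h3 := (h1.comp t h2).const_mul (u x ^ n)
      refine HasDerivAt.congr_deriv h3 ?_
      simp only [ContinuousMap.mul_apply, ContinuousMap.pow_apply, ContinuousMap.comp_apply,
        ContinuousMap.add_apply, ContinuousMap.smul_apply, ContinuousMap.const_apply, smul_eq_mul,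
        ContinuousMap.coe_mk]
      ring

open Convolution ContinuousLinearMap in
/-- A mollification of `σ` is a superposition of translates of `σ`, so composing it with `v`
stays in a closed subspace that contains the functions `σ (v + b)`. -/
theorem ridge_convolution_mem {S : Submodule ℝ C(X, ℝ)} (hS : IsClosed (S : Set C(X, ℝ)))
    {σ : ℝ → ℝ} (hσ : Continuous σ) (v : C(X, ℝ))
    (h : ∀ b : ℝ, (⟨σ, hσ⟩ : C(ℝ, ℝ)).comp (v + ContinuousMap.const X b) ∈ S)
    (φ : ContDiffBump (0 : ℝ)) {g : C(ℝ, ℝ)} (hg : ⇑g = φ.normed volume ⋆[lsmul ℝ ℝ, volume] σ) :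
    g.comp v ∈ S := by
  let G : C(ℝ × X, ℝ) := ⟨fun p => φ.normed volume p.1 * σ (v p.2 - p.1), by
    have := φ.continuous_normed (μ := (volume : Measure ℝ))
    fun_prop⟩
  have hint : Integrable (fun t => G.curry t) (volume : Measure ℝ) := by
    refine G.curry.continuous.integrable_of_hasCompactSupport ?_
    refine (φ.hasCompactSupport_normed (μ := (volume : Measure ℝ))).mono fun t ht => ?_
    contrapose! ht
    simp only [Function.mem_support, not_not] at ht ⊢
    ext x
    simp [G, ht]
  have hmem : ∫ t, G.curry t ∈ S := by
    refine Submodule.integral_mem_of_isClosed hS hint fun t => ?_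
    convert S.smul_mem (φ.normed volume t) (h (-t)) using 1
    ext x
    simp [G, sub_eq_add_neg]
  convert hmem using 1
  ext x
  rw [ContinuousMap.integral_apply hint]
  simp [hg, convolution_def, G]

open Convolution in
theorem ridge_pow_mem {S : Submodule ℝ C(X, ℝ)} (hS : IsClosed (S : Set C(X, ℝ)))
    {σ : ℝ → ℝ} (hσ : Continuous σ)
    (hσ' : ¬ ∃ p : Polynomial ℝ, ∀ x : ℝ, σ x = p.eval x) (u : C(X, ℝ))
    (h : ∀ a b : ℝ, (⟨σ, hσ⟩ : C(ℝ, ℝ)).comp (a • u + ContinuousMap.const X b) ∈ S) (n : ℕ) :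
    u ^ n ∈ S := by
  obtain ⟨φ, b, hb⟩ := exists_iteratedDeriv_convolution_ne_zero hσ hσ' n
  have hg := (φ.hasCompactSupport_normed
    (μ := (volume : Measure ℝ))).contDiff_convolution_left (n := ⊤)
    (ContinuousLinearMap.lsmul ℝ ℝ) (φ.contDiff_normed (μ := (volume : Measure ℝ)))
    (hσ.locallyIntegrable (μ := (volume : Measure ℝ)))
  have := ridge_pow_mul_iteratedDeriv_mem hS (u := u) (b := b) (g := ⟨_, hg.continuous⟩) hg
    (fun a => ridge_convolution_mem hS hσ _ (fun c => ?_) φ rfl) n 0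
  · convert S.smul_mem (_)⁻¹ this using 1
    rotate_left
    · exact iteratedDeriv n
        (φ.normed volume ⋆[ContinuousLinearMap.lsmul ℝ ℝ, volume] σ) b
    · ext x
      simp
      field_simp
  · convert h a (b + c) using 2
    ext x
    simp [add_assoc]

theorem exp_mem_of_pow_mem {S : Submodule ℝ C(X, ℝ)} (hS : IsClosed (S : Set C(X, ℝ)))
    {u : C(X, ℝ)} (h : ∀ n : ℕ, u ^ n ∈ S) : NormedSpace.exp u ∈ S :=
  hS.mem_of_tendsto (NormedSpace.exp_series_hasSum_exp' (𝕂 := ℝ) u)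
    (Filter.Eventually.of_forall fun _ => S.sum_mem fun n _ => S.smul_mem _ (h n))

/-- The density theorem for one-hidden-layer networks, stated for a point-separating subspace `U` of
`C(X, ℝ)` in the role of the linear functionals. -/
theorem eq_top_of_ridge_mem {S : Submodule ℝ C(X, ℝ)} (hS : IsClosed (S : Set C(X, ℝ)))
    {σ : ℝ → ℝ} (hσ : Continuous σ)
    (hσ' : ¬ ∃ p : Polynomial ℝ, ∀ x : ℝ, σ x = p.eval x) (U : Submodule ℝ C(X, ℝ))
    (hU : ∀ x y : X, x ≠ y → ∃ u ∈ U, u x ≠ u y)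
    (h : ∀ u ∈ U, ∀ b : ℝ, (⟨σ, hσ⟩ : C(ℝ, ℝ)).comp (u + ContinuousMap.const X b) ∈ S) :
    S = ⊤ := by
  have hexp : ∀ u ∈ U, NormedSpace.exp u ∈ S := fun u hu =>
    exp_mem_of_pow_mem hS (ridge_pow_mem hS hσ hσ' u fun a b => h _ (U.smul_mem a hu) b)
  let M : Submonoid C(X, ℝ) :=
    { carrier := NormedSpace.exp '' (U : Set C(X, ℝ))
      one_mem' := ⟨0, U.zero_mem, NormedSpace.exp_zero⟩
      mul_mem' := by
        rintro _ _ ⟨u, hu, rfl⟩ ⟨v, hv, rfl⟩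
        exact ⟨u + v, U.add_mem hu hv, NormedSpace.exp_add⟩ }
  have hsep : (Algebra.adjoin ℝ (M : Set C(X, ℝ))).SeparatesPoints := by
    intro x y hxy
    obtain ⟨u, hu, huxy⟩ := hU x y hxy
    refine ⟨_, ⟨_, Algebra.subset_adjoin ⟨u, hu, rfl⟩, rfl⟩, ?_⟩
    have hev : ∀ z : X, (NormedSpace.exp u) z = Real.exp (u z) := fun z => by
      rw [Real.exp_eq_exp_ℝ]
      exact NormedSpace.map_exp (ContinuousMap.evalAlgHom ℝ ℝ z)
        (continuous_eval_const z) u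
    simpa [hev] using huxy
  have htop := ContinuousMap.subalgebra_topologicalClosure_eq_top_of_separatesPoints _ hsep
  rw [eq_top_iff]
  intro f _
  have hf : f ∈ (Algebra.adjoin ℝ (M : Set C(X, ℝ))).topologicalClosure := htop ▸ trivial
  refine closure_minimal (fun g hg => ?_) hS hf
  have hg' : g ∈ Subalgebra.toSubmodule (Algebra.adjoin ℝ (M : Set C(X, ℝ))) := hg
  rw [Algebra.adjoin_eq_span, Submonoid.closure_eq] at hg'
  refine Submodule.span_le.2 ?_ hg'
  rintro _ ⟨u, hu, rfl⟩
  exact hexp u hu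

end Ridge

/-! ### Approximation by convolutional layers -/

/-- Universality of one-hidden-layer networks on compact subsets of `ℝ^ι`. -/
theorem exists_shallow_approx {σ : ℝ → ℝ} (hσ : Continuous σ)
    (hσ' : ¬ ∃ p : Polynomial ℝ, ∀ x : ℝ, σ x = p.eval x) {ι : Type*} [Fintype ι]
    {K : Set (ι → ℝ)} (hK : IsCompact K) {g : (ι → ℝ) → ℝ} (hg : Continuous g)
    {ε : ℝ} (hε : 0 < ε) :
    ∃ (m : ℕ) (c : Fin m → ℝ) (w : Fin m → ι → ℝ) (b : Fin m → ℝ),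
      ∀ x ∈ K, |∑ j, c j * σ ((∑ i, w j i * x i) + b j) - g x| < ε := by
  have : CompactSpace K := isCompact_iff_compactSpace.1 hK
  let lin : (ι → ℝ) →ₗ[ℝ] C(K, ℝ) :=
    { toFun := fun w => ⟨fun x => ∑ i, w i * x.1 i,
        continuous_finsetSum _ fun i _ =>
          continuous_const.mul ((continuous_apply i).comp continuous_subtype_val)⟩
      map_add' := fun v w => by ext x; simp [add_mul, Finset.sum_add_distrib]
      map_smul' := fun a w => by ext x; simp [Finset.mul_sum, mul_assoc] }
  let ridge : (ι → ℝ) × ℝ → C(K, ℝ) := fun p =>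
    (⟨σ, hσ⟩ : C(ℝ, ℝ)).comp (lin p.1 + ContinuousMap.const K p.2)
  have htop := eq_top_of_ridge_mem (S := (Submodule.span ℝ (Set.range ridge)).topologicalClosure)
    (Submodule.isClosed_topologicalClosure _) hσ hσ' (LinearMap.range lin)
    (fun x y hxy => by
      classical
      obtain ⟨i, hi⟩ := Function.ne_iff.1 (Subtype.coe_injective.ne hxy)
      refine ⟨_, ⟨Pi.single i 1, rfl⟩, ?_⟩
      simpa [lin, Pi.single_apply] using hi)
    (by
      rintro _ ⟨w, rfl⟩ b
      exact Submodule.le_topologicalClosure _ (Submodule.subset_span ⟨(w, b), rfl⟩))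
  have hmem : (⟨fun x : K => g x, by fun_prop⟩ : C(K, ℝ)) ∈
      closure (Submodule.span ℝ (Set.range ridge) : Set C(K, ℝ)) := by
    have : (⟨fun x : K => g x, by fun_prop⟩ : C(K, ℝ)) ∈
      (Submodule.span ℝ (Set.range ridge)).topologicalClosure := htop ▸ trivial
    exact this
  obtain ⟨f, hf, hfg⟩ := Metric.mem_closure_iff.1 hmem ε hε
  obtain ⟨m, c, p, rfl⟩ := Submodule.mem_span_set'.1 hf
  choose q hq using fun j => (p j).2
  refine ⟨m, c, fun j => (q j).1, fun j => (q j).2, fun x hx => ?_⟩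
  have h := (ContinuousMap.dist_lt_iff hε).1 hfg ⟨x, hx⟩
  rw [dist_comm, Real.dist_eq] at h
  simp only [← hq] at h
  simpa [ridge, lin, ContinuousMap.sum_apply] using h

theorem exists_ridge_sum_approx_id {σ : ℝ → ℝ} (hσ : Continuous σ)
    (hσ' : ¬ ∃ p : Polynomial ℝ, ∀ x : ℝ, σ x = p.eval x) (M : ℝ) {δ : ℝ} (hδ : 0 < δ) :
    ∃ (m : ℕ) (c w b : Fin m → ℝ),
      ∀ x : ℝ, |x| ≤ M → |∑ j, c j * σ (w j * x + b j) - x| < δ := by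
  obtain ⟨m, c, w, b, h⟩ := exists_shallow_approx hσ hσ'
    (isCompact_univ_pi fun _ : Unit => isCompact_Icc (a := -M) (b := M))
    (g := fun x => x ()) (by fun_prop) hδ
  refine ⟨m, c, fun j => w j (), b, fun x hx => ?_⟩
  simpa using h (fun _ => x) (fun _ _ => abs_le.1 hx)

/-- If the stride does not exceed the width `2 L_rf + 1` of a receptive field, the receptive fields
of the nodes of the coarser grid cover the finer grid. -/
theorem exists_readNode_eq {ν s Lrf r : ℕ} (hs : 1 ≤ s) (hsL : s ≤ 2 * Lrf + 1)
    (z : cubicGrid ν (gridRange s Lrf (r + 1))) :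
    ∃ (γ : cubicGrid ν (gridRange s Lrf r)) (θ : cubicGrid ν Lrf), readNode γ θ = z := by
  have hz := z.2
  simp only [cubicGrid, Finset.mem_Icc, Pi.le_def] at hz
  have key : ∀ i, ∃ a : ℤ, (-(gridRange s Lrf r : ℤ) ≤ a ∧ a ≤ gridRange s Lrf r) ∧
      (-(Lrf : ℤ) ≤ z.1 i - s * a ∧ z.1 i - s * a ≤ Lrf) := by
    intro i
    have h1 := hz.1 i
    have h2 := hz.2 i
    have hR : ((gridRange s Lrf (r + 1) : ℕ) : ℤ) = s * gridRange s Lrf r + Lrf := by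
      exact_mod_cast gridRange_succ s Lrf r
    have hs' : (1 : ℤ) ≤ s := by exact_mod_cast hs
    have hsL' : (s : ℤ) ≤ 2 * Lrf + 1 := by exact_mod_cast hsL
    have hdiv := Int.emod_add_mul_ediv (z.1 i + Lrf) s
    have hm0 := Int.emod_nonneg (z.1 i + Lrf) (by omega : (s : ℤ) ≠ 0)
    have hm1 := Int.emod_lt_of_pos (z.1 i + Lrf) (by omega : (0 : ℤ) < s)
    -- Division with remainder, `z i + L_rf = s * a + ρ` with `0 ≤ ρ < s`, leaves the offset
    -- `ρ - L_rf`, which lies in `[-L_rf, L_rf]`. A quotient `a` beyond the coarser grid is replaced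
    -- by the boundary of that grid.
    rcases le_or_gt ((z.1 i + Lrf) / s) (gridRange s Lrf r : ℤ) with h | h
    · refine ⟨(z.1 i + Lrf) / s, ⟨?_, h⟩, ?_, ?_⟩
      · rw [Int.le_ediv_iff_mul_le (by omega)]
        linarith
      · linarith
      · linarith
    · refine ⟨gridRange s Lrf r, ⟨by omega, le_rfl⟩, ?_, by linarith⟩
      have : (s : ℤ) * (gridRange s Lrf r + 1) ≤ s * ((z.1 i + Lrf) / s) :=
        mul_le_mul_of_nonneg_left (by omega) (by omega)
      linarith
  choose a ha hb using key
  refine ⟨⟨a, ?_⟩, ⟨fun i => z.1 i - s * a i, ?_⟩, ?_⟩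
  · simpa only [cubicGrid, Finset.mem_Icc, Pi.le_def] using
      ⟨fun i => (ha i).1, fun i => (ha i).2⟩
  · simpa only [cubicGrid, Finset.mem_Icc, Pi.le_def] using
      ⟨fun i => (hb i).1, fun i => (hb i).2⟩
  · ext i
    simp [readNode]

namespace ConvLayers

variable {σ : ℝ → ℝ} {ν Lrf : ℕ}

theorem continuous_eval (hσ : Continuous σ) (s : ℕ) {r d : ℕ} (N : ConvLayers ν Lrf r d) :
    Continuous (N.eval σ s) := by
  induction N with
  | readout w h =>
    simp only [eval]
    fun_prop
  | conv w h rest ih =>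
    simp only [eval]
    exact ih.comp (by fun_prop)

/-- A linear mixing of the features at each node can be absorbed into the weights of the layer that
follows it. -/
theorem exists_eval_eq_eval_mix (σ : ℝ → ℝ) (s : ℕ) {r d d' : ℕ} (N : ConvLayers ν Lrf r d)
    (c : Fin d → Fin d' → ℝ) :
    ∃ N' : ConvLayers ν Lrf r d',
      ∀ Φ, N'.eval σ s Φ = N.eval σ s fun γ k => ∑ j, c k j * Φ γ j := by
  cases N with
  | readout w h =>
    refine ⟨readout (fun j => ∑ k, w k * c k j) h, fun Φ => ?_⟩
    simp only [eval, Finset.sum_mul, Finset.mul_sum, mul_assoc]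
    rw [Finset.sum_comm]
  | conv w h rest =>
    refine ⟨conv (fun n θ j => ∑ k, w n θ k * c k j) h rest, fun Φ => ?_⟩
    simp only [eval, Finset.sum_mul, Finset.mul_sum, mul_assoc]
    congr! 6
    exact Finset.sum_comm

/-- Convolutional layers, at least one in number, followed by a readout approximate any continuous
function of the node values on a compact set. With no convolutional layer this fails, since the
readout alone is affine. -/
theorem exists_eval_approx (hσ : Continuous σ)
    (hσ' : ¬ ∃ p : Polynomial ℝ, ∀ x : ℝ, σ x = p.eval x) {s : ℕ} (hs : 1 ≤ s)
    (hsL : s ≤ 2 * Lrf + 1) {r d : ℕ}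
    {g : (cubicGrid ν (gridRange s Lrf (r + 1)) → Fin d → ℝ) → ℝ} (hg : Continuous g)
    {C : Set (cubicGrid ν (gridRange s Lrf (r + 1)) → Fin d → ℝ)} (hC : IsCompact C)
    {ε : ℝ} (hε : 0 < ε) :
    ∃ N : ConvLayers ν Lrf (r + 1) d, ∀ Φ ∈ C, |N.eval σ s Φ - g Φ| < ε := by
  induction r generalizing d ε with
  | zero =>
    choose γ θ hγθ using exists_readNode_eq (ν := ν) (r := 0) hs hsL
    -- The grid that remains after the layer has a single node.
    have hγ : ∀ z, γ z = ⟨0, zero_mem_cubicGrid ν _⟩ := fun z => by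
      have := (γ z).2
      simp only [cubicGrid, Finset.mem_Icc, Pi.le_def, gridRange, Finset.range_zero,
        Finset.sum_empty, mul_zero] at this
      ext i
      have h1 := this.1 i
      have h2 := this.2 i
      simp only [Nat.cast_zero, neg_zero] at h1 h2
      exact le_antisymm h2 h1
    let read : (cubicGrid ν (gridRange s Lrf 1) → Fin d → ℝ) → (cubicGrid ν Lrf × Fin d → ℝ) :=
      fun Φ p => Φ (readNode (r := 0) ⟨0, zero_mem_cubicGrid ν _⟩ p.1) p.2
    have hread : Continuous read := by fun_prop
    obtain ⟨m, c, w, b, h⟩ := exists_shallow_approx hσ hσ' (hC.image hread)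
      (g := fun x => g fun z k => x (θ z, k)) (by fun_prop) hε
    refine ⟨conv (fun n θ k => w n (θ, k)) b (readout c 0), fun Φ hΦ => ?_⟩
    have hΦ' := h _ ⟨Φ, hΦ, rfl⟩
    have hinv : (fun z k => read Φ (θ z, k)) = Φ := by
      funext z k
      simp only [read]
      rw [← hγ z, hγθ z]
    rw [hinv] at hΦ'
    simpa only [eval, add_zero, Fintype.sum_prod_type, read] using hΦ'
  | succ r ih =>
    choose γ θ hγθ using exists_readNode_eq (ν := ν) (r := r + 1) hs hsL
    let e := (Fintype.equivFin (cubicGrid ν Lrf × Fin d)).symm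
    let stack : (cubicGrid ν (gridRange s Lrf (r + 1 + 1)) → Fin d → ℝ) →
        (cubicGrid ν (gridRange s Lrf (r + 1)) →
          Fin (Fintype.card (cubicGrid ν Lrf × Fin d)) → ℝ) :=
      fun Φ z k => Φ (readNode z (e k).1) (e k).2
    have hstack : Continuous stack := by fun_prop
    -- `Φ` is recovered from `stack Φ` by looking up each node in a receptive field containing it.
    obtain ⟨N, hN⟩ := ih (g := fun Ψ => g fun z k => Ψ (γ z) (e.symm (θ z, k))) (by fun_prop)
      (hC.image hstack) (half_pos hε)
    obtain ⟨δ, hδ, hNδ⟩ := Metric.mem_uniformity_dist.1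
      ((hC.image hstack).uniformContinuousAt_of_continuousAt (N.eval σ s)
        (fun _ _ => (N.continuous_eval hσ s).continuousAt)
        (Metric.dist_mem_uniformity (half_pos hε)))
    obtain ⟨M, hM⟩ := (hC.image hstack).isBounded.exists_norm_le
    obtain ⟨m, c, w, b, hid⟩ := exists_ridge_sum_approx_id hσ hσ' M hδ
    let e' := (Fintype.equivFin (Fin (Fintype.card (cubicGrid ν Lrf × Fin d)) × Fin m)).symm
    -- Hidden feature `(k, j)` carries `σ (w j * x + b j)` for the stacked feature `x` of index
    -- `k`; the mixing recombines these over `j` with the coefficients `c j`.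
    obtain ⟨N', hN'⟩ := N.exists_eval_eq_eval_mix σ s
      (fun k n => if (e' n).1 = k then c (e' n).2 else 0)
    refine ⟨conv (fun n θ k => if (θ, k) = e (e' n).1 then w (e' n).2 else 0)
      (fun n => b (e' n).2) N', fun Φ hΦ => ?_⟩
    have hlin : ∀ (z : cubicGrid ν (gridRange s Lrf (r + 1))) (n : Fin (Fintype.card _)),
        ∑ θ, ∑ k, (if (θ, k) = e (e' n).1 then w (e' n).2 else 0) * Φ (readNode z θ) k =
          w (e' n).2 * stack Φ z (e' n).1 := by
      intro z n
      rw [← Fintype.sum_prod_type' (f := fun θ k =>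
        (if (θ, k) = e (e' n).1 then w (e' n).2 else 0) * Φ (readNode z θ) k)]
      simp [stack]
    have hmix : ∀ (z : cubicGrid ν (gridRange s Lrf (r + 1))) (k : Fin (Fintype.card _)),
        ∑ n, (if (e' n).1 = k then c (e' n).2 else 0) *
          σ (w (e' n).2 * stack Φ z (e' n).1 + b (e' n).2) =
        ∑ j, c j * σ (w j * stack Φ z k + b j) := by
      intro z k
      rw [e'.sum_comp fun p => (if p.1 = k then c p.2 else 0) *
        σ (w p.2 * stack Φ z p.1 + b p.2), Fintype.sum_prod_type_right]
      simp
    simp only [eval, hlin]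
    rw [hN']
    simp only [hmix]
    have hmem : stack Φ ∈ stack '' C := ⟨Φ, hΦ, rfl⟩
    have hclose : dist (stack Φ) (fun z k => ∑ j, c j * σ (w j * stack Φ z k + b j)) < δ := by
      rw [dist_pi_lt_iff hδ]
      intro z
      rw [dist_pi_lt_iff hδ]
      intro k
      rw [dist_comm, Real.dist_eq]
      exact hid _ (((norm_le_pi_norm (stack Φ z) k).trans
        (norm_le_pi_norm (stack Φ) z)).trans (hM _ hmem))
    have h1 := hNδ hclose hmem
    have h2 := hN _ hmem
    have hinv : (fun z k => stack Φ (γ z) (e.symm (θ z, k))) = Φ := by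
      funext z k
      simp only [stack, Equiv.apply_symm_apply]
      rw [hγθ z]
    simp only [hinv] at h2
    simp only [Real.dist_eq, abs_lt] at h1 h2 ⊢
    constructor <;> linarith [h1.1, h1.2, h2.1, h2.2]

end ConvLayers

/-! ### Discretization as orthogonal projection -/

section StepSignal

variable {ν dV : ℕ}

theorem gridCube_eq_preimage (spacing : ℝ) (k : Fin ν → ℤ) :
    gridCube spacing k = WithLp.ofLp ⁻¹' Set.Icc (fun i => ((k i : ℝ) - 1 / 2) * spacing)
      (fun i => ((k i : ℝ) + 1 / 2) * spacing) := by
  ext x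
  simp only [gridCube, Set.mem_ofPred_eq, Set.mem_preimage, Set.mem_Icc, Pi.le_def, forall_and]

theorem measurableSet_gridCube (spacing : ℝ) (k : Fin ν → ℤ) :
    MeasurableSet (gridCube spacing k) := by
  rw [gridCube_eq_preimage]
  exact (PiLp.volume_preserving_ofLp _).measurable measurableSet_Icc

theorem volume_gridCube {spacing : ℝ} (hs : 0 < spacing) (k : Fin ν → ℤ) :
    volume (gridCube spacing k) = ENNReal.ofReal (spacing ^ ν) := by
  rw [gridCube_eq_preimage, (PiLp.volume_preserving_ofLp _).measure_preimage
    measurableSet_Icc.nullMeasurableSet, Real.volume_Icc_pi]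
  ring_nf
  simp [ENNReal.ofReal_pow hs.le]

theorem volume_gridCube_ne_top (spacing : ℝ) (k : Fin ν → ℤ) :
    volume (gridCube spacing k) ≠ ⊤ := by
  rw [gridCube_eq_preimage, (PiLp.volume_preserving_ofLp _).measure_preimage
    measurableSet_Icc.nullMeasurableSet]
  exact isCompact_Icc.measure_lt_top.ne

theorem volume_gridCube_inter {spacing : ℝ} (hs : 0 < spacing) {k l : Fin ν → ℤ} (h : k ≠ l) :
    volume (gridCube spacing k ∩ gridCube spacing l) = 0 := by
  rw [gridCube_eq_preimage, gridCube_eq_preimage, ← Set.preimage_inter, Set.Icc_inter_Icc,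
    (PiLp.volume_preserving_ofLp _).measure_preimage measurableSet_Icc.nullMeasurableSet,
    Real.volume_Icc_pi]
  obtain ⟨i, hi⟩ := Function.ne_iff.1 h
  refine Finset.prod_eq_zero (Finset.mem_univ i) (ENNReal.ofReal_of_nonpos ?_)
  simp only [Pi.sup_apply, Pi.inf_apply, sub_nonpos]
  rcases lt_or_gt_of_ne hi with hlt | hlt
  · have : (k i : ℝ) + 1 ≤ l i := by exact_mod_cast hlt
    exact (inf_le_left.trans (mul_le_mul_of_nonneg_right (by linarith) hs.le)).trans le_sup_right
  · have : (l i : ℝ) + 1 ≤ k i := by exact_mod_cast hlt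
    exact (inf_le_right.trans (mul_le_mul_of_nonneg_right (by linarith) hs.le)).trans le_sup_left

theorem exists_mem_gridCube {spacing : ℝ} (hs : 0 < spacing) (x : EuclideanSpace ℝ (Fin ν)) :
    ∃ k, x ∈ gridCube spacing k := by
  refine ⟨fun i => round (x i / spacing), fun i => ?_⟩
  have h := abs_le.1 (abs_sub_round (x i / spacing))
  rw [← le_div_iff₀ hs, ← div_le_iff₀ hs]
  constructor <;> linarith [h.1, h.2]

/-- The signal equal to `y k` on the cube `Q_k` for `k ∈ Z_L`, and to `0` on the other cubes. -/
noncomputable def stepSignal (spacing : ℝ) (L : ℕ) (y : cubicGrid ν L → Fin dV → ℝ) : Signal ν dV :=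
  ∑ k, indicatorConstLp 2 (measurableSet_gridCube spacing k.1)
    (volume_gridCube_ne_top spacing k.1) (WithLp.toLp 2 (y k))

theorem continuous_stepSignal (spacing : ℝ) (L : ℕ) :
    Continuous (stepSignal (ν := ν) (dV := dV) spacing L) := by
  refine continuous_finsetSum _ fun k _ => ?_
  have h : Continuous fun c : EuclideanSpace ℝ (Fin dV) => indicatorConstLp 2
      (measurableSet_gridCube spacing k.1) (volume_gridCube_ne_top spacing k.1) c := by
    refine (LipschitzWith.of_dist_le_mul (K := Real.toNNReal (volume.real (gridCube spacing k.1) ^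
      (1 / (2 : ENNReal).toReal))) fun c c' => ?_).continuous
    rw [dist_eq_norm, indicatorConstLp_sub, dist_eq_norm, mul_comm,
      Real.coe_toNNReal _ (Real.rpow_nonneg measureReal_nonneg _)]
    exact norm_indicatorConstLp_le
  exact h.comp ((PiLp.continuous_toLp 2 _).comp (continuous_apply k))

theorem continuous_discretize (spacing : ℝ) (L : ℕ) :
    Continuous (discretize (ν := ν) (dV := dV) spacing L) := by
  refine continuous_pi fun k => continuous_pi fun n => ?_
  have h : ∀ Φ : Signal ν dV, discretize spacing L Φ k n = (spacing ^ ν)⁻¹ *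
      inner ℝ (indicatorConstLp 2 (measurableSet_gridCube spacing k.1)
        (volume_gridCube_ne_top spacing k.1) (EuclideanSpace.single n (1 : ℝ))) Φ := by
    intro Φ
    rw [L2.inner_indicatorConstLp_eq_inner_setIntegral, EuclideanSpace.inner_single_left]
    simp [discretize]
  simp_rw [h]
  fun_prop

/-- The error of replacing a signal by its means on the cubes is orthogonal to all step
functions. -/
theorem inner_stepSignal_sub_stepSignal_discretize {spacing : ℝ} (hs : 0 < spacing) (L : ℕ)
    (Φ : Signal ν dV) (y : cubicGrid ν L → Fin dV → ℝ) :
    inner ℝ (stepSignal spacing L y) (Φ - stepSignal spacing L (discretize spacing L Φ)) = 0 := by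
  conv_lhs => rw [stepSignal, sum_inner]
  refine Finset.sum_eq_zero fun k _ => ?_
  rw [inner_sub_right, stepSignal, inner_sum, Finset.sum_eq_single k]
  · rw [L2.inner_indicatorConstLp_indicatorConstLp _ _ (volume_gridCube_ne_top _ _)
        (volume_gridCube_ne_top _ _), L2.inner_indicatorConstLp_eq_inner_setIntegral,
      Set.inter_self, Measure.real, volume_gridCube hs, ENNReal.toReal_ofReal (by positivity)]
    have : WithLp.toLp 2 (discretize spacing L Φ k) =
      (spacing ^ ν)⁻¹ • ∫ x in gridCube spacing k.1, Φ x := rfl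
    rw [this, inner_smul_right, smul_eq_mul, mul_inv_cancel_left₀ (by positivity), sub_self]
  · intro l _ hl
    rw [L2.inner_indicatorConstLp_indicatorConstLp _ _ (volume_gridCube_ne_top _ _)
        (volume_gridCube_ne_top _ _), Measure.real,
      volume_gridCube_inter hs (Subtype.coe_injective.ne hl.symm), ENNReal.toReal_zero, zero_smul]
  · simp

/-- Discretization gives the best approximation among the step functions on the same cubes. -/
theorem norm_sub_stepSignal_discretize_le {spacing : ℝ} (hs : 0 < spacing) (L : ℕ)
    (Φ : Signal ν dV) (y : cubicGrid ν L → Fin dV → ℝ) :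
    ‖Φ - stepSignal spacing L (discretize spacing L Φ)‖ ≤ ‖Φ - stepSignal spacing L y‖ := by
  set P := stepSignal spacing L (discretize spacing L Φ)
  have h : inner ℝ (P - stepSignal spacing L y) (Φ - P) = 0 := by
    rw [inner_sub_left, inner_stepSignal_sub_stepSignal_discretize hs,
      inner_stepSignal_sub_stepSignal_discretize hs, sub_zero]
  have h2 := norm_add_sq_real (P - stepSignal spacing L y) (Φ - P)
  rw [h, sub_add_sub_cancel'] at h2
  refine (sq_le_sq₀ (norm_nonneg _) (norm_nonneg _)).1 ?_
  rw [h2]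
  nlinarith [sq_nonneg ‖P - stepSignal spacing L y‖]

/-- The cubes overlap on their faces, so the value of a step function on a cube is the prescribed
one only almost everywhere. -/
theorem ae_stepSignal_eq {spacing : ℝ} (hs : 0 < spacing) (L : ℕ)
    (y : cubicGrid ν L → Fin dV → ℝ) :
    ∀ᵐ x : EuclideanSpace ℝ (Fin ν), ∀ k, x ∈ gridCube spacing k →
      stepSignal spacing L y x = if h : k ∈ cubicGrid ν L then WithLp.toLp 2 (y ⟨k, h⟩) else 0 := by
  have h1 : ∀ᵐ x : EuclideanSpace ℝ (Fin ν), ∀ k l : Fin ν → ℤ, k ≠ l →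
      x ∉ gridCube spacing k ∩ gridCube spacing l := by
    simp only [ae_all_iff]
    intro k l hkl
    exact measure_eq_zero_iff_ae_notMem.1 (volume_gridCube_inter hs hkl)
  have h2 : ∀ᵐ x : EuclideanSpace ℝ (Fin ν), ∀ k : cubicGrid ν L,
      indicatorConstLp 2 (measurableSet_gridCube spacing k.1)
        (volume_gridCube_ne_top spacing k.1) (WithLp.toLp 2 (y k)) x =
      (gridCube spacing k.1).indicator (fun _ => WithLp.toLp 2 (y k)) x :=
    ae_all_iff.2 fun k => indicatorConstLp_coeFn
  have h3 := Lp.coeFn_finsetSum Finset.univ fun k : cubicGrid ν L =>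
      indicatorConstLp 2 (measurableSet_gridCube spacing k.1)
        (volume_gridCube_ne_top spacing k.1) (WithLp.toLp 2 (y k))
  filter_upwards [h1, h2, h3] with x hx1 hx2 hx3 k hk
  rw [stepSignal, hx3, Finset.sum_apply]
  simp only [hx2]
  split_ifs with h
  · rw [Finset.sum_eq_single ⟨k, h⟩, Set.indicator_of_mem hk]
    · intro l _ hl
      exact Set.indicator_of_notMem (fun hxl =>
        hx1 l.1 k (fun e => hl (Subtype.ext e)) ⟨hxl, hk⟩) _
    · simp
  · refine Finset.sum_eq_zero fun l _ => Set.indicator_of_notMem (fun hxl => ?_) _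
    exact hx1 l.1 k (fun e => h (e ▸ l.2)) ⟨hxl, hk⟩

theorem dist_le_of_mem_gridCube {spacing : ℝ} (hs : 0 < spacing) {k : Fin ν → ℤ}
    {x : EuclideanSpace ℝ (Fin ν)} (hx : x ∈ gridCube spacing k) :
    dist (WithLp.ofLp x) (fun i => k i * spacing) ≤ spacing / 2 := by
  refine (dist_pi_le_iff (by positivity)).2 fun i => ?_
  rw [Real.dist_eq, abs_le]
  constructor <;> linarith [(hx i).1, (hx i).2]

theorem lt_norm_of_mem_gridCube {spacing : ℝ} (hs : 0 < spacing) {L : ℕ} {k : Fin ν → ℤ}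
    {x : EuclideanSpace ℝ (Fin ν)} (hx : x ∈ gridCube spacing k) (hk : k ∉ cubicGrid ν L) :
    spacing * L < ‖WithLp.ofLp x‖ := by
  have : ∃ i, k i < -(L : ℤ) ∨ (L : ℤ) < k i := by
    by_contra! h
    refine hk ?_
    simpa only [cubicGrid, Finset.mem_Icc, Pi.le_def] using
      ⟨fun i => (h i).1, fun i => (h i).2⟩
  obtain ⟨i, hi⟩ := this
  refine lt_of_lt_of_le ?_ (norm_le_pi_norm _ i)
  rw [Real.norm_eq_abs]
  rcases hi with hi | hi
  · have hi' : (k i : ℝ) + 1 ≤ -L := by exact_mod_cast hi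
    refine lt_abs.2 (Or.inr ?_)
    have := (hx i).2
    nlinarith
  · have hi' : (L : ℝ) + 1 ≤ k i := by exact_mod_cast hi
    refine lt_abs.2 (Or.inl ?_)
    have := (hx i).1
    nlinarith

theorem exists_stepSignal_approx_of_hasCompactSupport
    {h : EuclideanSpace ℝ (Fin ν) → EuclideanSpace ℝ (Fin dV)} (hc : Continuous h)
    (hsupp : HasCompactSupport h) {Φ : Signal ν dV} (hΦ : Φ =ᵐ[volume] h) {ε : ℝ} (hε : 0 < ε) :
    ∃ η > (0 : ℝ), ∃ R : ℝ, ∀ spacing : ℝ, 0 < spacing → spacing ≤ η → ∀ L : ℕ,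
      R ≤ spacing * L → ∃ y : cubicGrid ν L → Fin dV → ℝ, ‖Φ - stepSignal spacing L y‖ ≤ ε := by
  -- The cubes are balls of the sup norm, so continuity and support are measured in that norm.
  let g : (Fin ν → ℝ) → EuclideanSpace ℝ (Fin dV) := fun x => h (WithLp.toLp 2 x)
  have hgc : Continuous g := hc.comp (PiLp.continuous_toLp 2 _)
  have hgs : HasCompactSupport g :=
    hsupp.comp_homeomorph (PiLp.homeomorph 2 (fun _ : Fin ν => ℝ)).symm
  obtain ⟨R, hR⟩ : ∃ R, ∀ x, R < ‖x‖ → g x = 0 := by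
    obtain ⟨R, hR⟩ := hgs.isCompact.isBounded.exists_norm_le
    exact ⟨R, fun x hx => by_contra fun h0 => hx.not_ge (hR x (subset_tsupport g h0))⟩
  let B : Set (EuclideanSpace ℝ (Fin ν)) := WithLp.ofLp ⁻¹' Metric.closedBall 0 (R + 1)
  have hB : MeasurableSet B :=
    (PiLp.volume_preserving_ofLp _).measurable Metric.isClosed_closedBall.measurableSet
  have hB' : volume B ≠ ⊤ := by
    rw [(PiLp.volume_preserving_ofLp _).measure_preimage
      Metric.isClosed_closedBall.measurableSet.nullMeasurableSet]
    exact (isCompact_closedBall _ _).measure_lt_top.ne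
  set V : ℝ := volume.real B ^ (1 / (2 : ENNReal).toReal)
  have hV : 0 ≤ V := Real.rpow_nonneg measureReal_nonneg _
  obtain ⟨η, hη, hgη⟩ := Metric.uniformContinuous_iff.1
    (hgs.uniformContinuous_of_continuous hgc) (ε / (V + 1)) (by positivity)
  refine ⟨min η 1, by positivity, R, fun spacing hs hsη L hRL => ?_⟩
  -- The step function takes on each cube the value of `h` at its centre.
  refine ⟨fun k => WithLp.ofLp (g fun i => k.1 i * spacing), ?_⟩
  have hle : ‖Φ - stepSignal spacing L (fun k => WithLp.ofLp (g fun i => k.1 i * spacing))‖ ≤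
      ‖indicatorConstLp (μ := volume) 2 hB hB' (ε / (V + 1))‖ := by
    refine Lp.norm_le_norm_of_ae_le ?_
    filter_upwards [hΦ, Lp.coeFn_sub Φ
      (stepSignal spacing L (fun k => WithLp.ofLp (g fun i => k.1 i * spacing))),
      ae_stepSignal_eq hs L (fun k => WithLp.ofLp (g fun i => k.1 i * spacing)),
      indicatorConstLp_coeFn (p := 2) (hs := hB) (hμs := hB') (c := ε / (V + 1))]
      with x hx1 hx2 hx3 hx4
    rw [hx2, hx4, Pi.sub_apply, hx1]
    obtain ⟨k, hk⟩ := exists_mem_gridCube hs x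
    rw [hx3 k hk]
    have hxg : h x = g (WithLp.ofLp x) := rfl
    have hdist := dist_le_of_mem_gridCube hs hk
    have hs1 : spacing ≤ 1 := hsη.trans (min_le_right _ _)
    have hs2 : spacing ≤ η := hsη.trans (min_le_left _ _)
    rw [hxg]
    by_cases hkL : k ∈ cubicGrid ν L
    · rw [dif_pos hkL]
      by_cases hxB : x ∈ B
      · rw [Set.indicator_of_mem hxB, ← dist_eq_norm, Real.norm_of_nonneg (by positivity)]
        exact (hgη (hdist.trans_lt (by linarith))).le
      · have hxR : R + 1 < ‖WithLp.ofLp x‖ := by simpa [B] using hxB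
        have hk0 : R < ‖fun i => (k i : ℝ) * spacing‖ := by
          have := norm_sub_norm_le (WithLp.ofLp x) (fun i => (k i : ℝ) * spacing)
          rw [← dist_eq_norm] at this
          linarith
        rw [hR _ (by linarith), hR _ hk0]
        simp
    · rw [dif_neg hkL, hR _ (hRL.trans_lt (lt_norm_of_mem_gridCube hs hk hkL))]
      simp
  refine hle.trans ?_
  rw [norm_indicatorConstLp two_ne_zero ENNReal.ofNat_ne_top, Real.norm_of_nonneg (by positivity),
    div_mul_eq_mul_div, div_le_iff₀ (by positivity)]
  exact mul_le_mul_of_nonneg_left (by linarith) hε.le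

theorem exists_stepSignal_approx (Φ : Signal ν dV) {ε : ℝ} (hε : 0 < ε) :
    ∃ η > (0 : ℝ), ∃ R : ℝ, ∀ spacing : ℝ, 0 < spacing → spacing ≤ η → ∀ L : ℕ,
      R ≤ spacing * L → ∃ y : cubicGrid ν L → Fin dV → ℝ, ‖Φ - stepSignal spacing L y‖ ≤ ε := by
  obtain ⟨h, hsupp, hle, hc, hmem⟩ := (Lp.memLp Φ).exists_hasCompactSupport_eLpNorm_sub_le
    ENNReal.ofNat_ne_top (ε := ENNReal.ofReal (ε / 2)) (by simpa using hε)
  obtain ⟨η, hη, R, hR⟩ := exists_stepSignal_approx_of_hasCompactSupport hc hsupp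
    hmem.coeFn_toLp (half_pos hε)
  refine ⟨η, hη, R, fun spacing hs hsη L hRL => ?_⟩
  obtain ⟨y, hy⟩ := hR spacing hs hsη L hRL
  refine ⟨y, ?_⟩
  have hle' : ‖Φ - hmem.toLp h‖ ≤ ε / 2 := by
    rw [← Lp.toLp_coeFn Φ (Lp.memLp Φ), ← MemLp.toLp_sub, Lp.norm_toLp]
    exact ENNReal.toReal_le_of_le_ofReal (by positivity) hle
  calc ‖Φ - stepSignal spacing L y‖
      ≤ ‖Φ - hmem.toLp h‖ + ‖hmem.toLp h - stepSignal spacing L y‖ :=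
        norm_sub_le_norm_sub_add_norm_sub _ _ _
    _ ≤ ε := by linarith

/-- Discretization is uniformly close to the identity on a compact set once the spacing is small and
the spatial range is large. -/
theorem exists_forall_mem_norm_sub_stepSignal_discretize_le {K : Set (Signal ν dV)}
    (hK : IsCompact K) {ε : ℝ} (hε : 0 < ε) :
    ∃ η > (0 : ℝ), ∃ R : ℝ, ∀ spacing : ℝ, 0 < spacing → spacing ≤ η → ∀ L : ℕ,
      R ≤ spacing * L → ∀ Φ ∈ K, ‖Φ - stepSignal spacing L (discretize spacing L Φ)‖ ≤ ε := by
  choose η hη R hR using fun Φ : Signal ν dV => exists_stepSignal_approx Φ (half_pos hε)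
  obtain ⟨t, -, htf, htK⟩ := hK.finite_cover_balls (half_pos hε)
  obtain ⟨η₀, hη₀, hη₀t⟩ : ∃ η₀ > (0 : ℝ), ∀ Ψ ∈ t, η₀ ≤ η Ψ := by
    rcases t.eq_empty_or_nonempty with rfl | hne
    · exact ⟨1, one_pos, by simp⟩
    · obtain ⟨Ψ, -, hΨ⟩ := Set.exists_min_image t η htf hne
      exact ⟨η Ψ, hη Ψ, hΨ⟩
  obtain ⟨R₀, hR₀⟩ := (htf.image R).bddAbove
  refine ⟨η₀, hη₀, R₀, fun spacing hs hsη L hRL Φ hΦ => ?_⟩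
  obtain ⟨Ψ, hΨ, hΦΨ⟩ := Set.mem_iUnion₂.1 (htK hΦ)
  obtain ⟨y, hy⟩ := hR Ψ spacing hs (hsη.trans (hη₀t Ψ hΨ)) L
    ((hR₀ ⟨Ψ, hΨ, rfl⟩).trans hRL)
  rw [Metric.mem_ball, dist_eq_norm] at hΦΨ
  calc ‖Φ - stepSignal spacing L (discretize spacing L Φ)‖
      ≤ ‖Φ - stepSignal spacing L y‖ := norm_sub_stepSignal_discretize_le hs L Φ y
    _ ≤ ‖Φ - Ψ‖ + ‖Ψ - stepSignal spacing L y‖ :=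
        norm_sub_le_norm_sub_add_norm_sub _ _ _
    _ ≤ ε := by linarith

end StepSignal

/-! ### Limit points of convnets -/

theorem DownsamplingConvnet.continuous_toFun {σ : ℝ → ℝ} (hσ : Continuous σ) {ν dV Lrf : ℕ} (s : ℕ)
    (N : DownsamplingConvnet ν dV Lrf) : Continuous (N.toFun σ s) :=
  (N.layers.continuous_eval hσ s).comp (continuous_discretize _ _)

theorem IsLimitPointOfDownsamplingConvnets.continuous {σ : ℝ → ℝ} (hσ : Continuous σ) {ν dV : ℕ}
    {f : Signal ν dV → ℝ} (hf : IsLimitPointOfDownsamplingConvnets σ f) : Continuous f := by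
  refine continuous_iff_seqContinuous.2 fun u Φ hu => ?_
  have hK := hu.isCompact_insert_range
  have hcont : ContinuousOn f (insert Φ (Set.range u)) := by
    refine continuousOn_of_uniform_approx_of_continuousOn fun U hU => ?_
    obtain ⟨ε, hε, hεU⟩ := Metric.mem_uniformity_dist.1 hU
    obtain ⟨N, -, -, hN⟩ := hf 1 1 le_rfl le_rfl (by norm_num) _ hK ε hε 1 one_pos 1 one_pos
    refine ⟨N.toFun σ 1, (N.continuous_toFun hσ 1).continuousOn, fun Ψ hΨ => hεU ?_⟩
    rw [dist_comm, ← edist_lt_ofReal]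
    exact (le_iSup₂ (f := fun Φ _ => edist (N.toFun σ 1 Φ) (f Φ)) Ψ hΨ).trans_lt hN
  have hin : Filter.Tendsto u Filter.atTop (nhdsWithin Φ (insert Φ (Set.range u))) :=
    tendsto_nhdsWithin_iff.2 ⟨hu, Filter.Eventually.of_forall fun n => Or.inr ⟨n, rfl⟩⟩
  exact (hcont Φ (Set.mem_insert _ _)).tendsto.comp hin

theorem le_gridRange {s Lrf : ℕ} (hs : 1 ≤ s) (hL : 1 ≤ Lrf) (r : ℕ) : r ≤ gridRange s Lrf r := by
  have h : (Finset.range r).card • 1 ≤ ∑ j ∈ Finset.range r, s ^ j :=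
    Finset.card_nsmul_le_sum _ _ _ fun j _ => Nat.one_le_pow _ _ hs
  rw [Finset.card_range, smul_eq_mul, mul_one] at h
  exact h.trans (Nat.le_mul_of_pos_left _ hL)

theorem isLimitPointOfDownsamplingConvnets_of_continuous {σ : ℝ → ℝ} (hσ : Continuous σ)
    (hσ' : ¬ ∃ p : Polynomial ℝ, ∀ x : ℝ, σ x = p.eval x) {ν dV : ℕ} {f : Signal ν dV → ℝ}
    (hf : Continuous f) : IsLimitPointOfDownsamplingConvnets σ f := by
  intro s Lrf hs hL hsL K hK ε hε spacing₀ hspacing₀ range₀ hrange₀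
  obtain ⟨δ, hδ, hfδ⟩ := Metric.mem_uniformity_dist.1
    (hK.uniformContinuousAt_of_continuousAt f (fun _ _ => hf.continuousAt)
      (Metric.dist_mem_uniformity (by positivity : 0 < ε / 4)))
  obtain ⟨η, hη, R, hR⟩ := exists_forall_mem_norm_sub_stepSignal_discretize_le hK (half_pos hδ)
  set spacing := min η spacing₀
  have hspacing : 0 < spacing := lt_min hη hspacing₀
  obtain ⟨r, hr⟩ := exists_nat_ge (max R range₀ / spacing)
  have hrange : max R range₀ ≤ spacing * (gridRange s Lrf (r + 1) : ℕ) := by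
    rw [div_le_iff₀' hspacing] at hr
    refine hr.trans (mul_le_mul_of_nonneg_left ?_ hspacing.le)
    exact_mod_cast (Nat.le_succ r).trans (le_gridRange hs hL (r + 1))
  obtain ⟨N, hN⟩ := ConvLayers.exists_eval_approx hσ hσ' hs hsL
    (hf.comp (continuous_stepSignal spacing (gridRange s Lrf (r + 1))))
    (hK.image (continuous_discretize spacing (gridRange s Lrf (r + 1))))
    (by positivity : 0 < ε / 4)
  refine ⟨⟨spacing, hspacing, r + 1, N⟩, min_le_right _ _, (le_max_right _ _).trans hrange, ?_⟩
  refine lt_of_le_of_lt (iSup₂_le fun Φ hΦ => ?_)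
    ((ENNReal.ofReal_lt_ofReal_iff hε).2 (half_lt_self hε))
  rw [edist_dist]
  refine ENNReal.ofReal_le_ofReal ?_
  have h1 := hN _ ⟨Φ, hΦ, rfl⟩
  have h2 := hR spacing hspacing (min_le_left _ _) _ ((le_max_left _ _).trans hrange) Φ hΦ
  rw [← dist_eq_norm] at h2
  have h3 : dist (f Φ) (f _) < ε / 4 := hfδ (h2.trans_lt (half_lt_self hδ)) hΦ
  rw [dist_comm] at h3
  rw [← Real.dist_eq] at h1
  exact ((dist_triangle _ _ _).trans (add_le_add h1.le h3.le)).trans (by linarith)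

theorem mainTheorem3 (σ : ℝ → ℝ) (hσ : Continuous σ)
    (hσ' : ¬ ∃ p : Polynomial ℝ, ∀ x : ℝ, σ x = p.eval x)
    (ν dV : ℕ) (f : Signal ν dV → ℝ) :
    IsLimitPointOfDownsamplingConvnets σ f ↔ Continuous f :=
  ⟨fun h => h.continuous hσ, isLimitPointOfDownsamplingConvnets_of_continuous hσ hσ'⟩
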